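/- The cake is $[0,1]$, to be divided among agents $1,\dots,n$. Agent $i$ has a private valuation function $V_i$, which assigns to every interval $[a,b]\subseteq[0,1]$ a value $V_i(a,b)\ge 0$, is normalised ($V_i(0,1)=1$), additive ($V_i(a,c)=V_i(a,b)+V_i(b,c)$ for $a\le b\le c$) and divisible (for every $[a,b]\subseteq[0,1]$ and $0\le\lambda\le1$ there is $c\in[a,b]$ with $V_i(a,c)=\lambda V_i(a,b)$), and is extended additively to finite unions of intervals with disjoint interiors. If agent $j$ receives $X_j$, then $envy(i,j)=\max(V_i(X_j)-V_i(X_i),0)$. A *branch choice (BC) protocol* is a finite rooted tree with three kinds of nodes. At every moment of its execution the cake is partitioned into $m$ contiguous pieces, ordered from left to right (initially $m=1$). - At a *cut node*, which has one child and carries a fixed agent $i$ and a fixed index $j\in\{1,\dots,m\}$, agent $i$ picks a point $z$ of the $j$-th piece $[x,y]$ (possibly an endpoint), and this piece is replaced by the two pieces $[x,z]$ and $[z,y]$. The protocol proceeds to the child. - At a *choose node*, which carries a fixed agent $i$ and has finitely many children (at least one), agent $i$ chooses the child to which the protocol proceeds. - Each *leaf* carries a map $\{1,\dots,m\}\to\{1,\dots,n\}$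 that allocates each of the $m$ pieces to an agent. Agents see all the previous cuts and choices. Agent $i$ with valuation $V_i$ *can guarantee* the bounds $envy(i,j)\le M_j$ for all $j\in S$ if some strategy of $i$ makes all of these bounds hold simultaneously, whatever strategies the other agents follow. Two protocols for the same $n$ agents are *strongly envy-equivalent* if, for every agent $i$, every valuation function $V_i$, every set $S$ of agents not containing $i$ and all $M_j\in[0,1]$ ($j\in S$), agent $i$ can guarantee $envy(i,j)\le M_j$ for all $j\in S$ in one of the protocols if and only if they can in the other. **Theorem.** For every BC protocol there is a strongly envy-equivalent BC protocol in which no choose node has a cut node among its descendants. -/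

import Mathlib

namespace CakeCutting

/-- A private valuation function on the cake `[0, 1]`: `V.val a b` is the value of the interval
`[a, b]`, constrained (and used) only for `0 ≤ a ≤ b ≤ 1`. -/
structure Valuation where
  val : ℝ → ℝ → ℝ
  normalized : val 0 1 = 1
  additive : ∀ a b c : ℝ, 0 ≤ a → a ≤ b → b ≤ c → c ≤ 1 → val a c = val a b + val b c
  divisible : ∀ a b r : ℝ, 0 ≤ a → a ≤ b → b ≤ 1 → 0 ≤ r → r ≤ 1 →
    ∃ c ∈ Set.Icc a b, val a c = r * val a b
  nonneg : ∀ a b : ℝ, 0 ≤ a → a ≤ b → b ≤ 1 → 0 ≤ val a b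

/-- A partition of the cake `[0, 1]` into `m` contiguous pieces, ordered from left to right; the
`j`-th piece is `[cut j, cut (j + 1)]`. Empty pieces `[x, x]` are allowed. -/
structure CakePartition (m : ℕ) where
  cut : Fin (m + 1) → ℝ
  mono : Monotone cut
  left_eq : cut 0 = 0
  right_eq : cut (Fin.last m) = 1

/-- The `j`-th piece of a partition. -/
def CakePartition.piece {m : ℕ} (c : CakePartition m) (j : Fin m) : Set ℝ :=
  Set.Icc (c.cut j.castSucc) (c.cut j.succ)

/-- The whole cake, as a single piece. -/
def CakePartition.whole : CakePartition 1 where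
  cut := ![0, 1]
  mono := by
    intro a b h
    fin_cases a <;> fin_cases b <;> simp_all
  left_eq := rfl
  right_eq := rfl

/-- Subdivide the `j`-th piece by a cut at the point `z` of that piece (trivial cuts at its
endpoints are allowed): the `j`-th piece `[x, y]` is replaced by `[x, z]` and `[z, y]`. -/
def CakePartition.split {m : ℕ} (c : CakePartition m) (j : Fin m) (z : c.piece j) :
    CakePartition (m + 1) where
  cut := Fin.insertNth (α := fun _ => ℝ) j.succ.castSucc (z : ℝ) c.cut
  mono := by
    obtain ⟨z, hz1, hz2⟩ := z
    intro a b
    refine Fin.succAboveCases j.succ.castSucc ?_ (fun a' => ?_) a <;>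
      refine Fin.succAboveCases j.succ.castSucc ?_ (fun b' => ?_) b
    · intro _
      exact le_rfl
    · intro h
      simp only [Fin.insertNth_apply_same, Fin.insertNth_apply_succAbove]
      refine hz2.trans (c.mono ?_)
      by_contra hlt
      rw [not_le] at hlt
      rw [Fin.succAbove_of_castSucc_lt _ _ (Fin.castSucc_lt_castSucc_iff.2 hlt)] at h
      exact absurd (Fin.castSucc_le_castSucc_iff.1 h) (not_le.2 hlt)
    · intro h
      simp only [Fin.insertNth_apply_same, Fin.insertNth_apply_succAbove]
      refine le_trans (c.mono ?_) hz1
      by_contra hlt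
      rw [not_le] at hlt
      have h1 : j.succ ≤ a' := Fin.castSucc_lt_iff_succ_le.1 hlt
      rw [Fin.succAbove_of_le_castSucc _ _ (Fin.castSucc_le_castSucc_iff.2 h1)] at h
      simp only [Fin.le_def, Fin.val_succ, Fin.val_castSucc] at h h1
      omega
    · intro h
      simp only [Fin.insertNth_apply_succAbove]
      exact c.mono ((Fin.strictMono_succAbove _).le_iff_le.1 h)
  left_eq := by
    have h : (0 : Fin (m + 1 + 1)) = j.succ.castSucc.succAbove 0 := by
      rw [Fin.succAbove_of_castSucc_lt _ _ (by simp [Fin.lt_def])]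
      rfl
    rw [h, Fin.insertNth_apply_succAbove]
    exact c.left_eq
  right_eq := by
    have h : Fin.last (m + 1) = j.succ.castSucc.succAbove (Fin.last m) := by
      rw [Fin.succAbove_of_le_castSucc _ _
        (Fin.castSucc_le_castSucc_iff.2 (Fin.le_last _))]
      rfl
    rw [h, Fin.insertNth_apply_succAbove]
    exact c.right_eq

/-- `BCTree n m` is the type of (sub)trees of branch choice protocols for `n` agents whose root is
reached when the cake is partitioned into `m` contiguous pieces.
* `leaf alloc`: the `p`-th piece is allocated to agent `alloc p`;
* `cut i j t`: agent `i` subdivides the `j`-th piece, then the protocol proceeds with `t`;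
* `choose i k ts`: agent `i` chooses to which of the `k + 1` children the protocol proceeds. -/
inductive BCTree (n : ℕ) : ℕ → Type
  | leaf {m : ℕ} (alloc : Fin m → Fin n) : BCTree n m
  | cut {m : ℕ} (i : Fin n) (j : Fin m) (child : BCTree n (m + 1)) : BCTree n m
  | choose {m : ℕ} (i : Fin n) (k : ℕ) (children : Fin (k + 1) → BCTree n m) : BCTree n m

/-- A branch choice (BC) protocol for `n` agents starts with the uncut cake. -/
abbrev BCProtocol (n : ℕ) : Type := BCTree n 1

/-- A strategy of agent `a`: a legal move for every node that `a` controls and every partition of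
the cake on reaching that node. (The node and the partition determine the whole execution history,
since the path to the node tells which pieces have been subdivided.) -/
def Strategy {n : ℕ} (a : Fin n) : {m : ℕ} → BCTree n m → Type
  | _, .leaf _ => Unit
  | m, .cut i j t => (i = a → (c : CakePartition m) → c.piece j) × Strategy a t
  | m, .choose i k ts => (i = a → CakePartition m → Fin (k + 1)) × (∀ b, Strategy a (ts b))

/-- An allocation of the cake to `n` agents: a partition into contiguous pieces, each of which is
given to an agent. -/
structure Allocation (n : ℕ) where
  size : ℕ
  partition : CakePartition size
  owner : Fin size → Fin n

/-- The allocation that results when every agent `a` follows the strategy `σ a`, starting from the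
partition `c`. -/
def play {n : ℕ} : {m : ℕ} → (t : BCTree n m) → (∀ a, Strategy a t) → CakePartition m →
    Allocation n
  | m, .leaf alloc, _, c => ⟨m, c, alloc⟩
  | _, .cut i j t, σ, c => play t (fun a => (σ a).2) (c.split j ((σ i).1 rfl c))
  | _, .choose i _ ts, σ, c =>
      play (ts ((σ i).1 rfl c)) (fun a => (σ a).2 ((σ i).1 rfl c)) c

/-- The value under `V` of everything that agent `j` receives in the allocation `A`. -/
def Allocation.share {n : ℕ} (A : Allocation n) (V : Valuation) (j : Fin n) : ℝ :=
  ∑ p : Fin A.size,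
    if A.owner p = j then V.val (A.partition.cut p.castSucc) (A.partition.cut p.succ) else 0

/-- The envy of agent `i`, who has valuation `V`, towards agent `j` in the allocation `A`. -/
def Allocation.envy {n : ℕ} (A : Allocation n) (V : Valuation) (i j : Fin n) : ℝ :=
  max (A.share V j - A.share V i) 0

/-- In the protocol `P`, agent `i` with valuation `V` can guarantee the simultaneous bounds
`envy(i, j) ≤ M j` for all `j ∈ S`: some strategy of `i` achieves them whatever strategies the
other agents follow. -/
def CanGuarantee {n : ℕ} (P : BCProtocol n) (i : Fin n) (V : Valuation) (S : Finset (Fin n))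
    (M : Fin n → ℝ) : Prop :=
  ∃ s : Strategy i P, ∀ σ : (∀ a, Strategy a P), σ i = s →
    ∀ j ∈ S, (play P σ CakePartition.whole).envy V i j ≤ M j

/-- Strong envy equivalence of two protocols. -/
def StronglyEnvyEquivalent {n : ℕ} (P Q : BCProtocol n) : Prop :=
  ∀ (i : Fin n) (V : Valuation) (S : Finset (Fin n)), i ∉ S →
    ∀ M : Fin n → ℝ, (∀ j ∈ S, M j ∈ Set.Icc (0 : ℝ) 1) →
      (CanGuarantee P i V S M ↔ CanGuarantee Q i V S M)

/-- Some node of the tree (possibly its root) is a cut node. -/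
def HasCutNode {n : ℕ} : {m : ℕ} → BCTree n m → Prop
  | _, .leaf _ => False
  | _, .cut _ _ _ => True
  | _, .choose _ _ ts => ∃ b, HasCutNode (ts b)

/-- No choose node of the tree has a cut node as a descendant. -/
def CutsBeforeChoices {n : ℕ} : {m : ℕ} → BCTree n m → Prop
  | _, .leaf _ => True
  | _, .cut _ _ t => CutsBeforeChoices t
  | _, .choose _ _ ts => ∀ b, ¬ HasCutNode (ts b) ∧ CutsBeforeChoices (ts b)

end CakeCutting

/-!
Whether agent `i` can guarantee some bounds is decided by a finite game of perfect information
between `i` and the coalition of all other agents. Backward induction turns the guarantee into a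
nested quantifier expression (`Wins`): a node of agent `i` is an existential quantifier over its
moves, a node of any other agent a universal one. The positional strategies of the protocol are
enough for both sides (`canGuarantee_iff_wins`).

For such expressions a cut can be moved in front of a choice at no cost, provided that it affects
only one branch: `(Q z, A z) ∨ B` is equivalent to `Q z, (A z ∨ B)` for either quantifier `Q`
over a nonempty piece, and likewise for `∧`. That the chooser now sees the cut beforehand is thus
irrelevant.

The remaining difficulty is that a cut which is made early is made physically, whereas the other
branches were designed for the coarser partition. A branch for `m` pieces has to be replaced by one
that is played on a finer partition and emulates the old pieces as unions of consecutive new ones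
(`Coarsening`). At a leaf, all parts of an old piece go to its owner. A cut of an old piece that now
consists of several new ones is emulated by letting the agent cut each of those in turn and choose,
each time, whether the cut just made is the one that counts (`exists_emulation_cut`). These choices
have to be moved behind further cuts themselves; `exists_merge` does so for a choice between a
protocol that already has its cuts in front and one that can be emulated on every refinement. Since
the subtree below a cut has this latter property by induction, every protocol has it
(`isEmulable`), and emulation on the partition itself is the theorem.
-/

namespace CakeCutting

/-! ### Backward induction -/

/-- Agent `i`, who has valuation `V`, wins the game that starts at the root of `t` with the
partition `c`, against the coalition of all other agents. The goal is that the vector of the values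
under `V` of all agents' shares satisfies `U`. -/
def Wins {n : ℕ} (i : Fin n) (V : Valuation) (U : (Fin n → ℝ) → Prop) :
    {m : ℕ} → BCTree n m → CakePartition m → Prop
  | m, .leaf alloc, c => U (Allocation.share ⟨m, c, alloc⟩ V)
  | _, .cut a j t, c =>
      (a = i ∧ ∃ z : c.piece j, Wins i V U t (c.split j z)) ∨
        (a ≠ i ∧ ∀ z : c.piece j, Wins i V U t (c.split j z))
  | _, .choose a _ ts, c =>
      (a = i ∧ ∃ b, Wins i V U (ts b) c) ∨ (a ≠ i ∧ ∀ b, Wins i V U (ts b) c)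

section Quantifiers

variable {n m : ℕ} {i a : Fin n} {V : Valuation} {U : (Fin n → ℝ) → Prop}

theorem wins_cut_self {j : Fin m} {t : BCTree n (m + 1)} {c : CakePartition m} :
    Wins i V U (.cut i j t) c ↔ ∃ z : c.piece j, Wins i V U t (c.split j z) := by
  simp [Wins]

theorem wins_cut_of_ne (h : a ≠ i) {j : Fin m} {t : BCTree n (m + 1)} {c : CakePartition m} :
    Wins i V U (.cut a j t) c ↔ ∀ z : c.piece j, Wins i V U t (c.split j z) := by
  simp [Wins, h]

theorem wins_choose_self {k : ℕ} {ts : Fin (k + 1) → BCTree n m} {c : CakePartition m} :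
    Wins i V U (.choose i k ts) c ↔ ∃ b, Wins i V U (ts b) c := by
  simp [Wins]

theorem wins_choose_of_ne (h : a ≠ i) {k : ℕ} {ts : Fin (k + 1) → BCTree n m}
    {c : CakePartition m} :
    Wins i V U (.choose a k ts) c ↔ ∀ b, Wins i V U (ts b) c := by
  simp [Wins, h]

end Quantifiers

theorem CakePartition.piece_nonempty {m : ℕ} (c : CakePartition m) (j : Fin m) :
    Nonempty (c.piece j) :=
  ⟨⟨c.cut j.castSucc, le_rfl, c.mono (Fin.castSucc_le_succ j)⟩⟩

theorem Strategy.nonempty {n : ℕ} (a : Fin n) : {m : ℕ} → (t : BCTree n m) →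
    Nonempty (Strategy a t)
  | _, .leaf _ => ⟨()⟩
  | _, .cut _ j t =>
      ⟨⟨fun _ c => (c.piece_nonempty j).some, (Strategy.nonempty a t).some⟩⟩
  | _, .choose _ _ ts => ⟨⟨fun _ _ => 0, fun b => (Strategy.nonempty a (ts b)).some⟩⟩

/-- The values under `V` of all agents' shares when the strategies `σ` are played. -/
abbrev outcome {n m : ℕ} (V : Valuation) (t : BCTree n m) (σ : ∀ a, Strategy a t)
    (c : CakePartition m) : Fin n → ℝ :=
  (play t σ c).share V

/-- One strategy of agent `i` wins from every partition from which `i` wins at all. -/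
theorem exists_winning_strategy {n : ℕ} (i : Fin n) (V : Valuation) (U : (Fin n → ℝ) → Prop)
    {m : ℕ} (t : BCTree n m) :
    ∃ s : Strategy i t, ∀ c, Wins i V U t c →
      ∀ σ : (∀ a, Strategy a t), σ i = s → U (outcome V t σ c) := by
  classical
  induction t with
  | leaf alloc => exact ⟨(), fun c h σ _ => h⟩
  | @cut m a j t ih =>
    obtain ⟨s, hs⟩ := ih
    by_cases ha : a = i
    · subst ha
      have hz : ∀ c : CakePartition m, ∃ z : c.piece j,
          Wins a V U (.cut a j t) c → Wins a V U t (c.split j z) := by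
        intro c
        by_cases h : Wins a V U (.cut a j t) c
        · obtain ⟨z, hz⟩ := wins_cut_self.1 h
          exact ⟨z, fun _ => hz⟩
        · exact ⟨(c.piece_nonempty j).some, fun h' => absurd h' h⟩
      choose z hz using hz
      refine ⟨(fun _ c => z c, s), fun c h σ hσ => ?_⟩
      refine hs _ ?_ (fun b => (σ b).2) (by rw [hσ])
      rw [hσ]
      exact hz c h
    · exact ⟨(fun h => absurd h ha, s), fun c h σ hσ =>
        hs _ ((wins_cut_of_ne ha).1 h _) (fun b => (σ b).2) (by rw [hσ])⟩
  | @choose m a k ts ih =>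
    choose s hs using ih
    by_cases ha : a = i
    · subst ha
      have hb : ∀ c : CakePartition m, ∃ b,
          Wins a V U (.choose a k ts) c → Wins a V U (ts b) c := by
        intro c
        by_cases h : Wins a V U (.choose a k ts) c
        · obtain ⟨b, hb⟩ := wins_choose_self.1 h
          exact ⟨b, fun _ => hb⟩
        · exact ⟨0, fun h' => absurd h' h⟩
      choose b hb using hb
      refine ⟨(fun _ c => b c, s), fun c h σ hσ => ?_⟩
      refine hs _ _ ?_ (fun d => (σ d).2 _) (by rw [hσ])
      rw [hσ]
      exact hb c h
    · exact ⟨(fun h => absurd h ha, s), fun c h σ hσ =>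
        hs _ _ ((wins_choose_of_ne ha).1 h _) (fun d => (σ d).2 _) (by rw [hσ])⟩

/-- One strategy profile of the other agents defeats agent `i` from every partition from which `i`
does not win. -/
theorem exists_defeating_profile {n : ℕ} (i : Fin n) (V : Valuation) (U : (Fin n → ℝ) → Prop)
    {m : ℕ} (t : BCTree n m) :
    ∃ τ : (∀ a, Strategy a t), ∀ c, ¬ Wins i V U t c →
      ∀ σ : (∀ a, Strategy a t), (∀ a, a ≠ i → σ a = τ a) → ¬ U (outcome V t σ c) := by
  classical
  induction t with
  | leaf alloc => exact ⟨fun _ => (), fun c h σ _ => h⟩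
  | @cut m a j t ih =>
    obtain ⟨τ, hτ⟩ := ih
    have hz : ∀ c : CakePartition m, ∃ z : c.piece j, a ≠ i →
        ¬ Wins i V U (.cut a j t) c → ¬ Wins i V U t (c.split j z) := by
      intro c
      by_cases h : a ≠ i ∧ ¬ Wins i V U (.cut a j t) c
      · have h2 := h.2
        rw [wins_cut_of_ne h.1, not_forall] at h2
        obtain ⟨z, hz⟩ := h2
        exact ⟨z, fun _ _ => hz⟩
      · exact ⟨(c.piece_nonempty j).some, fun h1 h2 => absurd ⟨h1, h2⟩ h⟩
    choose z hz using hz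
    refine ⟨fun d => (fun _ c => z c, τ d), fun c h σ hσ => ?_⟩
    refine hτ _ ?_ (fun d => (σ d).2) (fun d hd => by rw [hσ d hd])
    by_cases ha : a = i
    · subst ha
      rw [wins_cut_self, not_exists] at h
      exact h _
    · rw [hσ a ha]
      exact hz c ha h
  | @choose m a k ts ih =>
    choose τ hτ using ih
    have hb : ∀ c : CakePartition m, ∃ b, a ≠ i →
        ¬ Wins i V U (.choose a k ts) c → ¬ Wins i V U (ts b) c := by
      intro c
      by_cases h : a ≠ i ∧ ¬ Wins i V U (.choose a k ts) c
      · have h2 := h.2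
        rw [wins_choose_of_ne h.1, not_forall] at h2
        obtain ⟨b, hb⟩ := h2
        exact ⟨b, fun _ _ => hb⟩
      · exact ⟨0, fun h1 h2 => absurd ⟨h1, h2⟩ h⟩
    choose b hb using hb
    refine ⟨fun d => (fun _ c => b c, fun e => τ e d), fun c h σ hσ => ?_⟩
    refine hτ _ _ ?_ (fun d => (σ d).2 _) (fun d hd => by rw [hσ d hd])
    by_cases ha : a = i
    · subst ha
      rw [wins_choose_self, not_exists] at h
      exact h _
    · rw [hσ a ha]
      exact hb c ha h

theorem canGuarantee_iff_wins {n : ℕ} (P : BCProtocol n) (i : Fin n) (V : Valuation)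
    (S : Finset (Fin n)) (M : Fin n → ℝ) :
    CanGuarantee P i V S M ↔
      Wins i V (fun v => ∀ j ∈ S, max (v j - v i) 0 ≤ M j) P CakePartition.whole := by
  classical
  constructor
  · rintro ⟨s, hs⟩
    by_contra hW
    obtain ⟨τ, hτ⟩ := exists_defeating_profile i V (fun v => ∀ j ∈ S, max (v j - v i) 0 ≤ M j) P
    exact hτ _ hW (Function.update τ i s) (fun a ha => Function.update_of_ne ha _ _)
      (hs _ (Function.update_self _ _ _))
  · intro hW
    obtain ⟨s, hs⟩ := exists_winning_strategy i V (fun v => ∀ j ∈ S, max (v j - v i) 0 ≤ M j) P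
    exact ⟨s, fun σ hσ => hs _ hW σ hσ⟩

/-! ### Coarsenings of partitions -/

/-- A way to read a partition into `m'` pieces as a partition into `m` pieces, each of which is a
union of consecutive ones: the `j`-th cut point of the coarse partition is the `idx j`-th one of the
fine partition. As `idx` need not be injective, coarse pieces may be unions of no fine pieces. -/
structure Coarsening (m m' : ℕ) where
  idx : Fin (m + 1) → Fin (m' + 1)
  mono : Monotone idx
  zero : idx 0 = 0
  last : idx (Fin.last m) = Fin.last m'

@[ext]
theorem CakePartition.ext {m : ℕ} {c d : CakePartition m} (h : c.cut = d.cut) : c = d := by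
  cases c; cases d; cases h; rfl

/-- The coarse partition that `φ` reads off the fine partition `c`. -/
def CakePartition.coarsen {m m' : ℕ} (c : CakePartition m') (φ : Coarsening m m') :
    CakePartition m where
  cut := c.cut ∘ φ.idx
  mono := c.mono.comp φ.mono
  left_eq := by simp [φ.zero, c.left_eq]
  right_eq := by simp [φ.last, c.right_eq]

namespace Coarsening

/-- Every piece is read as itself. -/
protected def id (m : ℕ) : Coarsening m m := ⟨_root_.id, monotone_id, rfl, rfl⟩

/-- First read the fine partition by `ψ`, then the result by `φ`. -/
def comp {m m' m'' : ℕ} (ψ : Coarsening m' m'') (φ : Coarsening m m') : Coarsening m m'' :=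
  ⟨ψ.idx ∘ φ.idx, ψ.mono.comp φ.mono, by simp [φ.zero, ψ.zero], by simp [φ.last, ψ.last]⟩

end Coarsening

theorem monotone_insertNth {α : Type*} [Preorder α] {m : ℕ} {f : Fin (m + 1) → α}
    (hf : Monotone f) (j : Fin m) {z : α} (hz1 : f j.castSucc ≤ z) (hz2 : z ≤ f j.succ) :
    Monotone (Fin.insertNth (α := fun _ => α) j.succ.castSucc z f) := by
  intro a b
  refine Fin.succAboveCases j.succ.castSucc ?_ (fun a' => ?_) a <;>
    refine Fin.succAboveCases j.succ.castSucc ?_ (fun b' => ?_) b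
  · exact fun _ => le_rfl
  · intro h
    simp only [Fin.insertNth_apply_same, Fin.insertNth_apply_succAbove]
    refine hz2.trans (hf ?_)
    by_contra hlt
    rw [not_le] at hlt
    rw [Fin.succAbove_of_castSucc_lt _ _ (Fin.castSucc_lt_castSucc_iff.2 hlt)] at h
    exact absurd (Fin.castSucc_le_castSucc_iff.1 h) (not_le.2 hlt)
  · intro h
    simp only [Fin.insertNth_apply_same, Fin.insertNth_apply_succAbove]
    refine le_trans (hf ?_) hz1
    by_contra hlt
    rw [not_le] at hlt
    have h1 : j.succ ≤ a' := Fin.castSucc_lt_iff_succ_le.1 hlt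
    rw [Fin.succAbove_of_le_castSucc _ _ (Fin.castSucc_le_castSucc_iff.2 h1)] at h
    simp only [Fin.le_def, Fin.val_succ, Fin.val_castSucc] at h h1
    omega
  · intro h
    simp only [Fin.insertNth_apply_succAbove]
    exact hf ((Fin.strictMono_succAbove _).le_iff_le.1 h)

theorem succAbove_zero_of_cut {m : ℕ} (j : Fin m) :
    j.succ.castSucc.succAbove 0 = (0 : Fin (m + 1 + 1)) := by
  rw [Fin.succAbove_of_castSucc_lt _ _ (by simp [Fin.lt_def])]
  rfl

theorem succAbove_last_of_cut {m : ℕ} (j : Fin m) :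
    j.succ.castSucc.succAbove (Fin.last m) = Fin.last (m + 1) := by
  rw [Fin.succAbove_of_le_castSucc _ _ (Fin.castSucc_le_castSucc_iff.2 (Fin.le_last _))]
  rfl

namespace Coarsening

/-- Forget the cut that has subdivided the `j`-th piece. -/
def forget {m : ℕ} (j : Fin m) : Coarsening m (m + 1) :=
  ⟨j.succ.castSucc.succAbove, (Fin.strictMono_succAbove _).monotone,
    succAbove_zero_of_cut j, succAbove_last_of_cut j⟩

/-- Subdivide the `j`-th coarse piece at the fine cut point with index `p`. -/
def insert {m m' : ℕ} (φ : Coarsening m m') (j : Fin m) (p : Fin (m' + 1))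
    (h1 : φ.idx j.castSucc ≤ p) (h2 : p ≤ φ.idx j.succ) : Coarsening (m + 1) m' where
  idx := Fin.insertNth (α := fun _ => Fin (m' + 1)) j.succ.castSucc p φ.idx
  mono := monotone_insertNth φ.mono j h1 h2
  zero := by rw [← succAbove_zero_of_cut j, Fin.insertNth_apply_succAbove, φ.zero]
  last := by rw [← succAbove_last_of_cut j, Fin.insertNth_apply_succAbove, φ.last]

end Coarsening

theorem CakePartition.coarsen_id {m : ℕ} (c : CakePartition m) :
    c.coarsen (Coarsening.id m) = c := rfl

theorem CakePartition.coarsen_comp {m m' m'' : ℕ} (c : CakePartition m'') (ψ : Coarsening m' m'')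
    (φ : Coarsening m m') : c.coarsen (ψ.comp φ) = (c.coarsen ψ).coarsen φ := rfl

theorem CakePartition.split_coarsen_forget {m : ℕ} (c : CakePartition m) (j : Fin m)
    (z : c.piece j) : (c.split j z).coarsen (Coarsening.forget j) = c := by
  ext p
  exact Fin.insertNth_apply_succAbove (α := fun _ => ℝ) _ _ _ _

theorem CakePartition.split_coarsen_comp {m m' : ℕ} (c : CakePartition m') (k : Fin m')
    (z : c.piece k) (φ : Coarsening m m') :
    (c.split k z).coarsen ((Coarsening.forget k).comp φ) = c.coarsen φ := by
  rw [coarsen_comp, split_coarsen_forget]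

theorem CakePartition.split_congr {m : ℕ} {c d : CakePartition m} (h : c = d) (j : Fin m)
    {z : c.piece j} {w : d.piece j} (hzw : (z : ℝ) = w) : c.split j z = d.split j w := by
  subst h
  rw [Subtype.ext hzw]

theorem CakePartition.coarsen_insert {m m' : ℕ} (c : CakePartition m') (φ : Coarsening m m')
    (j : Fin m) (p : Fin (m' + 1)) (h1 : φ.idx j.castSucc ≤ p) (h2 : p ≤ φ.idx j.succ) :
    c.coarsen (φ.insert j p h1 h2) =
      (c.coarsen φ).split j ⟨c.cut p, c.mono h1, c.mono h2⟩ := by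
  ext q
  refine Fin.succAboveCases j.succ.castSucc ?_ (fun q' => ?_) q
  · simp [coarsen, split, Coarsening.insert]
  · simp [coarsen, split, Coarsening.insert]

/-! ### Shares under coarsening -/

theorem Coarsening.exists_piece {m m' : ℕ} (φ : Coarsening m m') (p : Fin m') :
    ∃ j : Fin m, φ.idx j.castSucc ≤ p.castSucc ∧ p.succ ≤ φ.idx j.succ := by
  by_contra! h
  have key : ∀ j : Fin (m + 1), φ.idx j ≤ p.castSucc := by
    intro j
    induction j using Fin.induction with
    | zero => rw [φ.zero]; exact Fin.zero_le _
    | succ j ih => exact Fin.le_castSucc_iff.2 (h j ih)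
  have := key (Fin.last m)
  rw [φ.last] at this
  exact absurd this (not_le.2 (Fin.castSucc_lt_last p))

/-- The coarse piece that contains the `p`-th fine piece. -/
noncomputable def Coarsening.pieceOf {m m' : ℕ} (φ : Coarsening m m') (p : Fin m') : Fin m :=
  (φ.exists_piece p).choose

theorem Coarsening.pieceOf_eq_iff {m m' : ℕ} (φ : Coarsening m m') (p : Fin m') (j : Fin m) :
    φ.pieceOf p = j ↔ φ.idx j.castSucc ≤ p.castSucc ∧ p.succ ≤ φ.idx j.succ := by
  have h : φ.idx (φ.pieceOf p).castSucc ≤ p.castSucc ∧ p.succ ≤ φ.idx (φ.pieceOf p).succ :=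
    (φ.exists_piece p).choose_spec
  constructor
  · rintro rfl
    exact h
  · intro h'
    have aux : ∀ a b : Fin m, p.succ ≤ φ.idx a.succ → φ.idx b.castSucc ≤ p.castSucc →
        ¬ a < b := by
      intro a b ha hb hab
      have h1 : φ.idx a.succ ≤ φ.idx b.castSucc := φ.mono (Fin.succ_le_castSucc_iff.2 hab)
      exact absurd ((ha.trans h1).trans hb) (not_le.2 Fin.castSucc_lt_succ)
    exact le_antisymm (not_lt.1 (aux _ _ h'.2 h.1)) (not_lt.1 (aux _ _ h.2 h'.1))

theorem sum_fin_sub {m : ℕ} (F : Fin (m + 1) → ℝ) :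
    ∑ p : Fin m, (F p.succ - F p.castSucc) = F (Fin.last m) - F 0 := by
  have h := (Fin.sum_univ_succ F).symm.trans (Fin.sum_univ_castSucc F)
  rw [Finset.sum_sub_distrib]
  linarith

theorem sum_fin_sub_between {m : ℕ} (F : Fin (m + 1) → ℝ) {a b : Fin (m + 1)} (hab : a ≤ b) :
    (∑ p : Fin m, if a ≤ p.castSucc ∧ p.succ ≤ b then F p.succ - F p.castSucc else 0) =
      F b - F a := by
  -- Clamping the index to `[a, b]` makes the terms outside vanish.
  have h := sum_fin_sub (fun x => F (max a (min x b)))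
  rw [min_eq_right (Fin.le_last b), max_eq_right hab, min_eq_left (Fin.zero_le b),
    max_eq_left (Fin.zero_le a)] at h
  rw [← h]
  refine Finset.sum_congr rfl fun p _ => ?_
  have hp : p.castSucc ≤ p.succ := Fin.castSucc_le_succ p
  split_ifs with hc
  · rw [min_eq_left hc.2, max_eq_right (hc.1.trans hp), min_eq_left (hp.trans hc.2),
      max_eq_right hc.1]
  · rw [not_and_or, not_le, not_le] at hc
    rcases hc with hc | hc
    · have h1 : p.succ ≤ a := Fin.castSucc_lt_iff_succ_le.1 hc
      rw [max_eq_left ((min_le_left _ _).trans h1), max_eq_left ((min_le_left _ _).trans hc.le),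
        sub_self]
    · have h1 : b ≤ p.castSucc := Fin.le_castSucc_iff.2 hc
      rw [min_eq_right hc.le, min_eq_right h1, sub_self]

theorem CakePartition.cut_nonneg {m : ℕ} (c : CakePartition m) (p : Fin (m + 1)) :
    0 ≤ c.cut p := c.left_eq ▸ c.mono (Fin.zero_le p)

theorem CakePartition.cut_le_one {m : ℕ} (c : CakePartition m) (p : Fin (m + 1)) :
    c.cut p ≤ 1 := c.right_eq ▸ c.mono (Fin.le_last p)

theorem CakePartition.val_cut {m : ℕ} (c : CakePartition m) (V : Valuation) {p q : Fin (m + 1)}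
    (h : p ≤ q) : V.val (c.cut p) (c.cut q) = V.val 0 (c.cut q) - V.val 0 (c.cut p) := by
  rw [V.additive 0 _ _ le_rfl (c.cut_nonneg p) (c.mono h) (c.cut_le_one q)]
  ring

theorem share_coarsen {n m m' : ℕ} (c : CakePartition m') (φ : Coarsening m m')
    (alloc : Fin m → Fin n) (V : Valuation) :
    Allocation.share ⟨m', c, alloc ∘ φ.pieceOf⟩ V =
      Allocation.share ⟨m, c.coarsen φ, alloc⟩ V := by
  funext x
  have h1 : ∀ p : Fin m', (if alloc (φ.pieceOf p) = x then
      V.val (c.cut p.castSucc) (c.cut p.succ) else 0) =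
      ∑ j : Fin m, if φ.pieceOf p = j then (if alloc j = x then
        V.val (c.cut p.castSucc) (c.cut p.succ) else 0) else 0 := by
    intro p
    rw [Finset.sum_ite_eq]
    simp
  simp only [Allocation.share, Function.comp_apply]
  rw [Finset.sum_congr rfl fun p _ => h1 p, Finset.sum_comm]
  refine Finset.sum_congr rfl fun j _ => ?_
  by_cases hj : alloc j = x
  · simp only [hj, if_true, φ.pieceOf_eq_iff]
    have hle : φ.idx j.castSucc ≤ φ.idx j.succ := φ.mono (Fin.castSucc_le_succ j)
    have h2 : V.val ((c.coarsen φ).cut j.castSucc) ((c.coarsen φ).cut j.succ) = _ :=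
      c.val_cut V hle
    rw [h2, ← sum_fin_sub_between (fun q => V.val 0 (c.cut q)) hle]
    refine Finset.sum_congr rfl fun p _ => ?_
    rw [c.val_cut V (Fin.castSucc_le_succ p)]
  · simp [hj]

/-! ### Emulation on finer partitions -/

/-- Playing `t'` on a fine partition is the same, for every agent's guarantees, as playing `t` on
the coarse partition that `φ` reads off it. -/
def Emulates {n m m' : ℕ} (t' : BCTree n m') (φ : Coarsening m m') (t : BCTree n m) : Prop :=
  ∀ i V U c, Wins i V U t' c ↔ Wins i V U t (c.coarsen φ)

/-- On every refinement, `t` can be emulated by a tree that has its cuts in front. -/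
def IsEmulable {n m : ℕ} (t : BCTree n m) : Prop :=
  ∀ (m' : ℕ) (φ : Coarsening m m'), ∃ t' : BCTree n m', CutsBeforeChoices t' ∧ Emulates t' φ t

theorem cutsBeforeChoices_of_not_hasCutNode {n m : ℕ} {t : BCTree n m} (h : ¬ HasCutNode t) :
    CutsBeforeChoices t := by
  induction t with
  | leaf => trivial
  | cut => exact absurd trivial h
  | choose a k ts ih =>
    rw [HasCutNode, not_exists] at h
    exact fun b => ⟨h b, ih b (h b)⟩

theorem emulates_leaf {n m m' : ℕ} (alloc : Fin m → Fin n) (φ : Coarsening m m') :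
    Emulates (.leaf (alloc ∘ φ.pieceOf)) φ (.leaf alloc) := by
  intro i V U c
  rw [Wins, Wins, share_coarsen]

theorem exists_emulates_of_not_hasCutNode {n m m' : ℕ} (t : BCTree n m) (φ : Coarsening m m')
    (h : ¬ HasCutNode t) : ∃ t' : BCTree n m', ¬ HasCutNode t' ∧ Emulates t' φ t := by
  induction t with
  | leaf alloc => exact ⟨.leaf (alloc ∘ φ.pieceOf), h, emulates_leaf alloc φ⟩
  | cut => exact absurd trivial h
  | choose a k ts ih =>
    rw [HasCutNode, not_exists] at h
    choose ts' h1 h2 using fun b => ih b φ (h b)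
    refine ⟨.choose a k ts', not_exists.2 h1, fun i V U c => ?_⟩
    simp only [Wins, h2 _ i V U c]

/-! ### Cuts in front of a choice between two subtrees -/

/-- The choice by agent `a` between two outcomes for agent `i`, given by whether `i` wins. -/
def Either {n : ℕ} (a i : Fin n) (p q : Prop) : Prop :=
  (a = i ∧ (p ∨ q)) ∨ (a ≠ i ∧ (p ∧ q))

theorem either_comm {n : ℕ} {a i : Fin n} {p q : Prop} : Either a i p q ↔ Either a i q p := by
  simp only [Either, or_comm (a := p), and_comm (a := p)]

theorem either_self {n : ℕ} {i : Fin n} {p q : Prop} : Either i i p q ↔ p ∨ q := by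
  simp [Either]

theorem either_of_ne {n : ℕ} {a i : Fin n} (h : a ≠ i) {p q : Prop} :
    Either a i p q ↔ p ∧ q := by
  simp [Either, h]

theorem wins_choose_pair {n m : ℕ} (a i : Fin n) (V : Valuation) (U : (Fin n → ℝ) → Prop)
    (s t : BCTree n m) (c : CakePartition m) :
    Wins i V U (.choose a 1 ![s, t]) c ↔ Either a i (Wins i V U s c) (Wins i V U t c) := by
  simp [Wins, Either, Fin.exists_fin_two, Fin.forall_fin_two]

/-- A cut by agent `b` in one branch of a choice by agent `a` may precede the choice: if the other
branch `X` is emulated after the cut, its result does not depend on where the cut is made. -/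
theorem wins_cut_either {n m : ℕ} {a b i : Fin n} {V : Valuation} {U : (Fin n → ℝ) → Prop}
    {j : Fin m} {s t : BCTree n (m + 1)} {c : CakePartition m} {X : Prop}
    (h : ∀ z : c.piece j, Wins i V U t (c.split j z) ↔ Either a i (Wins i V U s (c.split j z)) X) :
    Wins i V U (.cut b j t) c ↔ Either a i (Wins i V U (.cut b j s) c) X := by
  have := c.piece_nonempty j
  by_cases hb : b = i <;> by_cases ha : a = i <;> [subst hb; subst hb; subst ha; skip]
  · subst ha
    simp only [wins_cut_self, h, either_self, exists_or, exists_const]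
  · simp only [wins_cut_self, h, either_of_ne ha, exists_and_right]
  · simp only [wins_cut_of_ne hb, h, either_self, forall_or_right]
  · simp only [wins_cut_of_ne hb, h, either_of_ne ha, forall_and, forall_const]

/-- A choice between a tree without cuts and one that has its cuts in front is equivalent to a tree
that has its cuts in front: trees without cuts can be emulated without cuts, so the cuts of the
other tree only have to be moved before the choice one by one. -/
theorem exists_merge_of_not_hasCutNode {n m m₀ : ℕ} (a : Fin n) {t₀ : BCTree n m₀}
    (h₀ : ¬ HasCutNode t₀) (t₁ : BCTree n m) (h₁ : CutsBeforeChoices t₁) (φ : Coarsening m₀ m) :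
    ∃ t : BCTree n m, CutsBeforeChoices t ∧ ∀ i V U c, Wins i V U t c ↔
      Either a i (Wins i V U t₁ c) (Wins i V U t₀ (c.coarsen φ)) := by
  have main : ∀ {m : ℕ} (t₁ : BCTree n m) (φ : Coarsening m₀ m), ¬ HasCutNode t₁ →
      ∃ t : BCTree n m, CutsBeforeChoices t ∧ ∀ i V U c, Wins i V U t c ↔
        Either a i (Wins i V U t₁ c) (Wins i V U t₀ (c.coarsen φ)) := by
    intro m t₁ φ h₁
    obtain ⟨t₀', h₀', he⟩ := exists_emulates_of_not_hasCutNode t₀ φ h₀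
    refine ⟨.choose a 1 ![t₁, t₀'], ?_, fun i V U c => ?_⟩
    · refine cutsBeforeChoices_of_not_hasCutNode ?_
      rw [HasCutNode, Fin.exists_fin_two]
      exact not_or.2 ⟨h₁, h₀'⟩
    · rw [wins_choose_pair, he]
  induction t₁ with
  | leaf alloc => exact main _ φ (fun h => h)
  | choose b k ts => exact main _ φ (not_exists.2 fun b => (h₁ b).1)
  | cut b j s ih =>
    obtain ⟨t, ht, hw⟩ := ih h₁ ((Coarsening.forget j).comp φ)
    refine ⟨.cut b j t, ht, fun i V U c => wins_cut_either fun z => ?_⟩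
    rw [hw, c.split_coarsen_comp]

/-- A choice between a tree that has its cuts in front and one that is emulable is equivalent to a
tree that has its cuts in front: the cuts of the first tree are made, then those of an emulation of
the second tree on the resulting partition, and then the choice. -/
theorem exists_merge {n m m₁ : ℕ} (a : Fin n) (t₀ : BCTree n m) (h₀ : CutsBeforeChoices t₀)
    {t₁ : BCTree n m₁} (h₁ : IsEmulable t₁) (φ : Coarsening m₁ m) :
    ∃ t : BCTree n m, CutsBeforeChoices t ∧ ∀ i V U c, Wins i V U t c ↔
      Either a i (Wins i V U t₀ c) (Wins i V U t₁ (c.coarsen φ)) := by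
  have main : ∀ {m : ℕ} (t₀ : BCTree n m) (φ : Coarsening m₁ m), ¬ HasCutNode t₀ →
      ∃ t : BCTree n m, CutsBeforeChoices t ∧ ∀ i V U c, Wins i V U t c ↔
        Either a i (Wins i V U t₀ c) (Wins i V U t₁ (c.coarsen φ)) := by
    intro m t₀ φ h₀
    obtain ⟨t₁', h₁', he⟩ := h₁ m φ
    obtain ⟨t, ht, hw⟩ := exists_merge_of_not_hasCutNode a h₀ t₁' h₁' (Coarsening.id m)
    refine ⟨t, ht, fun i V U c => ?_⟩
    rw [hw, either_comm, he, c.coarsen_id]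
  induction t₀ with
  | leaf alloc => exact main _ φ (fun h => h)
  | choose b k ts => exact main _ φ (not_exists.2 fun b => (h₀ b).1)
  | cut b j s ih =>
    obtain ⟨t, ht, hw⟩ := ih h₀ ((Coarsening.forget j).comp φ)
    refine ⟨.cut b j t, ht, fun i V U c => wins_cut_either fun z => ?_⟩
    rw [hw, c.split_coarsen_comp]

/-! ### Every tree is emulable -/

theorem isEmulable_choose {n m : ℕ} (a : Fin n) (k : ℕ) (ts : Fin (k + 1) → BCTree n m)
    (h : ∀ b, IsEmulable (ts b)) : IsEmulable (.choose a k ts) := by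
  intro m' φ
  induction k with
  | zero =>
    obtain ⟨t', h1, h2⟩ := h 0 m' φ
    refine ⟨t', h1, fun i V U c => ?_⟩
    rw [h2]
    by_cases ha : a = i
    · subst ha
      simp [wins_choose_self]
    · simp [wins_choose_of_ne ha]
  | succ k ih =>
    obtain ⟨t', h1, h2⟩ := ih (fun b => ts b.castSucc) (fun b => h _)
    obtain ⟨t, ht, hw⟩ := exists_merge a t' h1 (h (Fin.last _)) φ
    refine ⟨t, ht, fun i V U c => ?_⟩
    rw [hw, h2]
    by_cases ha : a = i
    · subst ha
      rw [either_self, wins_choose_self, wins_choose_self]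
      exact (Fin.exists_fin_succ' (P := fun b => Wins a V U (ts b) (c.coarsen φ))).symm
    · rw [either_of_ne ha, wins_choose_of_ne ha, wins_choose_of_ne ha]
      exact (Fin.forall_fin_succ' (P := fun b => Wins i V U (ts b) (c.coarsen φ))).symm

/-- Emulation of a cut by agent `a` of the `j`-th coarse piece, with the position `z` of the cut
restricted to the part of that piece to the right of the fine cut point `p`. This part consists of
`r` fine pieces; `a` cuts the leftmost of them and chooses between using this cut and emulating a
cut of the other `r - 1` ones. -/
theorem exists_emulation_cut {n m : ℕ} (a : Fin n) (j : Fin m) {t : BCTree n (m + 1)}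
    (ht : IsEmulable t) (r : ℕ) : ∀ (m' : ℕ) (φ : Coarsening m m') (p : Fin (m' + 1)),
    φ.idx j.castSucc ≤ p → (p : ℕ) + r = φ.idx j.succ →
    ∃ t' : BCTree n m', CutsBeforeChoices t' ∧ ∀ i V U c, Wins i V U t' c ↔
      (a = i ∧ ∃ z : (c.coarsen φ).piece j, c.cut p ≤ z ∧
        Wins i V U t ((c.coarsen φ).split j z)) ∨
      (a ≠ i ∧ ∀ z : (c.coarsen φ).piece j, c.cut p ≤ z →
        Wins i V U t ((c.coarsen φ).split j z)) := by
  induction r with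
  | zero =>
    -- The only admissible position of the cut is the right end of the coarse piece.
    intro m' φ p hp hr
    have hq : p = φ.idx j.succ := Fin.ext hr
    obtain ⟨t', h1, h2⟩ := ht m' (φ.insert j p hp hq.le)
    refine ⟨t', h1, fun i V U c => ?_⟩
    rw [h2, c.coarsen_insert]
    have hz : ∀ z : (c.coarsen φ).piece j, c.cut p ≤ z →
        z = ⟨c.cut p, c.mono hp, c.mono hq.le⟩ := by
      intro z hz
      exact Subtype.ext (le_antisymm (z.2.2.trans (congrArg c.cut hq).ge) hz)
    by_cases ha : a = i
    · simp only [ha, true_and, ne_eq, not_true_eq_false, false_and, or_false]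
      constructor
      · exact fun h => ⟨_, le_rfl, h⟩
      · rintro ⟨z, h3, h4⟩
        rwa [hz z h3] at h4
    · simp only [ha, false_and, ne_eq, not_false_eq_true, true_and, false_or]
      constructor
      · intro h z h3
        rwa [hz z h3]
      · exact fun h => h _ le_rfl
  | succ r ih =>
    intro m' φ p hp hr
    have hpm : (p : ℕ) < m' := by have := (φ.idx j.succ).is_lt; omega
    -- The leftmost fine piece of the range, as an index of a piece.
    obtain ⟨k, rfl⟩ : ∃ k : Fin m', p = k.castSucc := ⟨⟨p, hpm⟩, rfl⟩
    have hk : k.succ ≤ φ.idx j.succ := by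
      rw [Fin.le_def, Fin.val_succ]
      rw [Fin.val_castSucc] at hr
      omega
    -- After the cut, the indices of the left end of the fine piece, of the cut, and of the right
    -- end of the fine piece are `k`, `k + 1` and `k + 2`.
    have hf1 : (Coarsening.forget k).idx k.castSucc = k.castSucc.castSucc :=
      Fin.succAbove_of_castSucc_lt _ _ (by simp [Fin.lt_def])
    have hf2 : ∀ q : Fin (m' + 1), k.succ ≤ q → (Coarsening.forget k).idx q = q.succ :=
      fun q hq => Fin.succAbove_of_le_castSucc _ _ (Fin.castSucc_le_castSucc_iff.2 hq)
    have hl : ((Coarsening.forget k).comp φ).idx j.castSucc ≤ k.castSucc.castSucc :=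
      hf1 ▸ (Coarsening.forget k).mono hp
    have hu : ((Coarsening.forget k).comp φ).idx j.succ = (φ.idx j.succ).succ := hf2 _ hk
    obtain ⟨t₀, h₀, hw₀⟩ := ih (m' + 1) ((Coarsening.forget k).comp φ) k.succ.succ
      (hl.trans (by simp only [Fin.le_def, Fin.val_succ, Fin.val_castSucc]; omega))
      (by rw [hu]; simp only [Fin.val_succ, Fin.val_castSucc] at hr ⊢; omega)
    have hl' : ((Coarsening.forget k).comp φ).idx j.castSucc ≤ k.succ.castSucc :=
      hl.trans (by simp only [Fin.le_def, Fin.val_succ, Fin.val_castSucc]; omega)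
    have hu' : k.succ.castSucc ≤ ((Coarsening.forget k).comp φ).idx j.succ := by
      rw [hu]
      simp only [Fin.le_def, Fin.val_succ, Fin.val_castSucc] at hk ⊢
      omega
    obtain ⟨t₂, h₂, hw₂⟩ := exists_merge a t₀ h₀ ht
      (((Coarsening.forget k).comp φ).insert j k.succ.castSucc hl' hu')
    refine ⟨.cut a k t₂, h₂, fun i V U c => ?_⟩
    have hz1 : ∀ z : c.piece k, (c.split k z).cut k.succ.castSucc = z := fun z =>
      Fin.insertNth_apply_same (α := fun _ => ℝ) _ _ _
    have hz2 : ∀ z : c.piece k, (c.split k z).cut k.succ.succ = c.cut k.succ := fun z => by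
      rw [← hf2 _ le_rfl]
      exact Fin.insertNth_apply_succAbove (α := fun _ => ℝ) _ _ _ _
    have hmem : ∀ z : c.piece k, (z : ℝ) ∈ (c.coarsen φ).piece j := fun z =>
      ⟨(c.mono hp).trans z.2.1, z.2.2.trans (c.mono hk)⟩
    have hsplit : ∀ z : c.piece k, (c.split k z).coarsen
        (((Coarsening.forget k).comp φ).insert j k.succ.castSucc hl' hu') =
        (c.coarsen φ).split j ⟨z, hmem z⟩ := by
      intro z
      rw [CakePartition.coarsen_insert]
      exact CakePartition.split_congr (c.split_coarsen_comp k z φ) j (hz1 z)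
    have hw : ∀ z : c.piece k, Wins i V U t₀ (c.split k z) ↔
        (a = i ∧ ∃ w : (c.coarsen φ).piece j, c.cut k.succ ≤ w ∧
          Wins i V U t ((c.coarsen φ).split j w)) ∨
        (a ≠ i ∧ ∀ w : (c.coarsen φ).piece j, c.cut k.succ ≤ w →
          Wins i V U t ((c.coarsen φ).split j w)) := by
      intro z
      rw [hw₀, hz2, c.split_coarsen_comp]
    have hkk : c.cut k.castSucc ≤ c.cut k.succ := c.mono (Fin.castSucc_le_succ k)
    obtain ⟨z₀⟩ := c.piece_nonempty k
    by_cases ha : a = i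
    · subst ha
      simp only [wins_cut_self, hw₂, either_self, hw, hsplit, true_and, ne_eq,
        not_true_eq_false, false_and, or_false]
      constructor
      · rintro ⟨z, ⟨w, h1, h2⟩ | h⟩
        · exact ⟨w, hkk.trans h1, h2⟩
        · exact ⟨_, z.2.1, h⟩
      · rintro ⟨w, h1, h2⟩
        rcases le_total (c.cut k.succ) w with h3 | h3
        · exact ⟨z₀, Or.inl ⟨w, h3, h2⟩⟩
        · exact ⟨⟨w, h1, h3⟩, Or.inr h2⟩
    · simp only [wins_cut_of_ne ha, hw₂, either_of_ne ha, hw, hsplit, ha, false_and, ne_eq,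
        not_false_eq_true, true_and, false_or]
      constructor
      · intro h w h1
        rcases le_total (c.cut k.succ) w with h3 | h3
        · exact (h z₀).1 w h3
        · exact (h ⟨w, h1, h3⟩).2
      · exact fun h z => ⟨fun w h3 => h w (hkk.trans h3), h _ z.2.1⟩

theorem isEmulable {n m : ℕ} (t : BCTree n m) : IsEmulable t := by
  induction t with
  | leaf alloc => exact fun m' φ => ⟨.leaf (alloc ∘ φ.pieceOf), trivial, emulates_leaf alloc φ⟩
  | choose a k ts ih => exact isEmulable_choose a k ts ih
  | cut a j t ih =>
    intro m' φ
    have hle : φ.idx j.castSucc ≤ φ.idx j.succ := φ.mono (Fin.castSucc_le_succ j)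
    obtain ⟨t', h1, h2⟩ := exists_emulation_cut a j ih _ m' φ (φ.idx j.castSucc) le_rfl
      (Nat.add_sub_of_le hle)
    refine ⟨t', h1, fun i V U c => ?_⟩
    have hz : ∀ z : (c.coarsen φ).piece j, c.cut (φ.idx j.castSucc) ≤ z := fun z => z.2.1
    rw [h2, Wins]
    simp only [hz, true_and, true_imp_iff]

end CakeCutting

theorem mainTheorem5 {n : ℕ} (P : CakeCutting.BCProtocol n) :
    ∃ Q : CakeCutting.BCProtocol n,
      CakeCutting.StronglyEnvyEquivalent P Q ∧ CakeCutting.CutsBeforeChoices Q := by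
  obtain ⟨Q, hQ, he⟩ := CakeCutting.isEmulable P 1 (CakeCutting.Coarsening.id 1)
  refine ⟨Q, fun i V S _ M _ => ?_, hQ⟩
  rw [CakeCutting.canGuarantee_iff_wins, CakeCutting.canGuarantee_iff_wins, he,
    CakeCutting.CakePartition.coarsen_id]
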